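/- Let $\&$ be a continuous t-norm on $[0,1]$, that is, a continuous, commutative, associative binary operation on $[0,1]$ that is monotone in each variable and has unit $1$; let $x\to y=\sup\{z\in[0,1]\mid x\mathbin{\&}z\le y\}$ be its implication. A \emph{real-enriched category} is a set $X$ with a map $X(-,-)\colon X\times X\to[0,1]$ such that $X(x,x)=1$ and $X(y,z)\mathbin{\&}X(x,y)\le X(x,z)$ for all $x,y,z\in X$. A \emph{functor} $f\colon X\to Y$ is a map with $X(x,y)\le Y(f(x),f(y))$ for all $x,y\in X$; it is \emph{fully faithful} if equality always holds. These form the category $[0,1]\text{-}\mathbf{Cat}$. A \emph{weight} of $X$ is a map $\phi\colon X\to[0,1]$ with $\phi(y)\mathbin{\&}X(x,y)\le\phi(x)$ for all $x,y\in X$. The weights of $X$ form a real-enriched category $\mathcal{P}X$ with $\mathcal{P}X(\phi,\psi)=\inf_{x\in X}(\phi(x)\to\psi(x))$. The \emph{presheaf monad} $\mathbb{P}=(\mathcal{P},\mathsf{m},\mathsf{y})$ on $[0,1]\text{-}\mathbf{Cat}$ is given by the functor $\mathcal{P}$, which sends $f\colon X\to Y$ to $\mathcal{P}f\colon\mathcal{P}X\to\mathcal{P}Y$,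 $(\mathcal{P}f)(\phi)(y)=\sup_{x\in X}\phi(x)\mathbin{\&}Y(y,f(x))$, by the Yoneda embeddings $\mathsf{y}_X\colon X\to\mathcal{P}X$, $a\mapsto X(-,a)$, and by the functors $\mathsf{m}_X\colon\mathcal{P}\mathcal{P}X\to\mathcal{P}X$ sending each weight of $\mathcal{P}X$ to its colimit, $\mathsf{m}_X(\Phi)(x)=\Phi(\mathsf{y}_X(x))$. Let $\mathbb{P}\text{-}\mathbf{Alg}$ be its Eilenberg--Moore category; its objects, the $\mathbb{P}$-algebras, are the separated cocomplete real-enriched categories and its morphisms are the left adjoint functors between them. The free $\mathbb{P}$-algebra on $X$ is $(\mathcal{P}X,\mathsf{m}_X)$. A $\mathbb{P}$-algebra $A$ is a \emph{subalgebra} of a $\mathbb{P}$-algebra $B$ if there is a fully faithful $\mathbb{P}$-homomorphism $A\to B$. Then the following are equivalent: (1) The continuous t-norm $\&$ is isomorphic to the Łukasiewicz t-norm, i.e. there is an order-preserving bijection $f\colon[0,1]\to[0,1]$ with $f(x\mathbin{\&}y)=\max\{f(x)+f(y)-1,0\}$ for all $x,y\in[0,1]$. (2) Every $\mathbb{P}$-algebra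 $A$ is a subalgebra, in $\mathbb{P}\text{-}\mathbf{Alg}$, of the free algebra $\mathcal{P}X$ for some real-enriched category $X$. -/

import Mathlib

open CategoryTheory unitInterval

universe u

/-- A continuous t-norm on `[0,1]`. -/
structure ContinuousTNorm where
  /-- the operation `x & y` -/
  op : I → I → I
  comm : ∀ x y, op x y = op y x
  assoc : ∀ x y z, op (op x y) z = op x (op y z)
  mono_right : ∀ x y z, y ≤ z → op x y ≤ op x z
  op_one : ∀ x, op x 1 = x
  continuous_op : Continuous fun p : I × I => op p.1 p.2

namespace ContinuousTNorm

/-- The Łukasiewicz t-norm `x & y = max (x + y - 1) 0`. -/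
noncomputable def lukasiewicz : ContinuousTNorm where
  op x y := ⟨max ((x : ℝ) + y - 1) 0, le_max_right _ _,
    max_le (by linarith [x.2.2, y.2.2]) zero_le_one⟩
  comm x y := by ext; simp [add_comm]
  assoc x y z := by
    ext
    have hx := x.2; have hy := y.2; have hz := z.2
    simp only [Set.mem_Icc] at hx hy hz
    simp only
    rcases le_total ((x : ℝ) + y - 1) 0 with h | h <;>
      rcases le_total ((y : ℝ) + z - 1) 0 with h' | h' <;>
      simp only [max_eq_left, max_eq_right, h, h'] <;>
      first
        | (rw [max_eq_right (by linarith), max_eq_right (by linarith)])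
        | (congr 1; ring)
  mono_right x y z h := by
    have h' : (y : ℝ) ≤ z := h
    exact Subtype.mk_le_mk.2 (max_le_max (by linarith) le_rfl)
  op_one x := by
    ext
    simpa using x.2.1
  continuous_op := by
    refine Continuous.subtype_mk ?_ _
    fun_prop

/-- Isomorphism of t-norms on `[0,1]`. -/
def IsIsomorphic (S T : ContinuousTNorm) : Prop :=
  ∃ f : I ≃o I, ∀ x y, f (S.op x y) = T.op (f x) (f y)

variable (T : ContinuousTNorm)

/-- The implication `x → y`, the right adjoint of `x & -`; see `le_imp_iff`. -/
noncomputable def imp (x y : I) : I := sSup {z | T.op x z ≤ y}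

theorem mono_left {x y : I} (h : x ≤ y) (z : I) : T.op x z ≤ T.op y z := by
  rw [T.comm x, T.comm y]; exact T.mono_right z x y h

theorem op_mono {x x' y y' : I} (h : x ≤ x') (h' : y ≤ y') : T.op x y ≤ T.op x' y' :=
  (T.mono_left h y).trans (T.mono_right x' y y' h')

theorem one_op (x : I) : T.op 1 x = x := by rw [T.comm, T.op_one]

theorem op_zero (x : I) : T.op x 0 = 0 :=
  le_antisymm (by simpa [T.one_op] using T.mono_left (le_one' : x ≤ 1) 0) nonneg'

theorem op_le_left (x y : I) : T.op x y ≤ x := by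
  simpa [T.op_one] using T.mono_right x y 1 le_one'

theorem le_imp_iff {x y z : I} : z ≤ T.imp x y ↔ T.op x z ≤ y := by
  refine ⟨fun h => ?_, fun h => le_sSup h⟩
  have hc : Continuous (T.op x) :=
    T.continuous_op.comp (continuous_const.prodMk continuous_id)
  have hm : Monotone (T.op x) := fun a b hab => T.mono_right x a b hab
  have hs : T.op x (T.imp x y) = sSup (T.op x '' {z | T.op x z ≤ y}) :=
    hm.map_sSup_of_continuousAt hc.continuousAt (T.op_zero x)
  refine (T.mono_right x _ _ h).trans ?_
  rw [hs]
  refine sSup_le ?_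
  rintro _ ⟨w, hw, rfl⟩
  exact hw

theorem op_iSup_le {ι : Sort*} {x y : I} {f : ι → I} :
    T.op x (⨆ i, f i) ≤ y ↔ ∀ i, T.op x (f i) ≤ y := by
  rw [← T.le_imp_iff, iSup_le_iff]
  simp only [T.le_imp_iff]

theorem iSup_op_le {ι : Sort*} {x y : I} {f : ι → I} :
    T.op (⨆ i, f i) x ≤ y ↔ ∀ i, T.op (f i) x ≤ y := by
  simp only [T.comm _ x, T.op_iSup_le]

end ContinuousTNorm

/-- A real-enriched category, with respect to the t-norm `T`. -/
structure RealCat (T : ContinuousTNorm) where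
  carrier : Type u
  /-- the degree `X(x,y)` to which `x` is below `y` -/
  hom : carrier → carrier → I
  hom_self : ∀ x, hom x x = 1
  hom_comp : ∀ x y z, T.op (hom y z) (hom x y) ≤ hom x z

namespace RealCat

variable {T : ContinuousTNorm}

/-- A functor between real-enriched categories. -/
@[ext] structure Functor (X Y : RealCat.{u} T) where
  map : X.carrier → Y.carrier
  hom_le : ∀ x y, X.hom x y ≤ Y.hom (map x) (map y)

/-- The category `[0,1]-Cat` of real-enriched categories and functors. -/
instance : Category (RealCat.{u} T) where
  Hom X Y := Functor X Y
  id X := ⟨fun x => x, fun _ _ => le_rfl⟩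
  comp f g := ⟨fun x => g.map (f.map x), fun x y => (f.hom_le x y).trans (g.hom_le _ _)⟩

/-- A functor is fully faithful if it preserves the degrees `X(x,y)` exactly. -/
def FullyFaithful {X Y : RealCat.{u} T} (f : X ⟶ Y) : Prop :=
  ∀ x y, X.hom x y = Y.hom (Functor.map f x) (Functor.map f y)

theorem hom_ext {X Y : RealCat.{u} T} {f g : X ⟶ Y}
    (h : ∀ x, Functor.map f x = Functor.map g x) : f = g :=
  Functor.ext (funext h)

/-- A weight of `X`: a distributor from `X` to the terminal category. -/
@[ext] structure Weight (X : RealCat.{u} T) where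
  val : X.carrier → I
  op_le : ∀ x y, T.op (val y) (X.hom x y) ≤ val x

/-- The category `𝒫 X` of weights of `X`, where
`𝒫 X (φ, ψ) = inf_x (φ x → ψ x)`. -/
noncomputable abbrev presheaf (X : RealCat.{u} T) : RealCat.{u} T where
  carrier := Weight X
  hom φ ψ := ⨅ x, T.imp (φ.val x) (ψ.val x)
  hom_self φ := by
    refine le_antisymm le_one' (le_iInf fun x => ?_)
    rw [T.le_imp_iff, T.op_one]
  hom_comp φ ψ χ := by
    refine le_iInf fun x => ?_
    have h₁ : T.op (φ.val x) (⨅ x, T.imp (φ.val x) (ψ.val x)) ≤ ψ.val x :=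
      T.le_imp_iff.1 (iInf_le _ x)
    have h₂ : T.op (ψ.val x) (⨅ x, T.imp (ψ.val x) (χ.val x)) ≤ χ.val x :=
      T.le_imp_iff.1 (iInf_le _ x)
    rw [T.le_imp_iff, T.comm (⨅ x, T.imp (ψ.val x) (χ.val x)), ← T.assoc]
    exact (T.mono_left h₁ _).trans h₂

theorem le_presheaf_hom {X : RealCat.{u} T} {φ ψ : Weight X} {r : I} :
    r ≤ (presheaf X).hom φ ψ ↔ ∀ x, T.op (φ.val x) r ≤ ψ.val x := by
  change r ≤ ⨅ x, T.imp (φ.val x) (ψ.val x) ↔ _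
  simp only [le_iInf_iff, T.le_imp_iff]

/-- The representable weight `𝗒(a) = X(-, a)`. -/
def representable (X : RealCat.{u} T) (a : X.carrier) : Weight X where
  val x := X.hom x a
  op_le x y := X.hom_comp x y a

theorem yoneda_lemma {X : RealCat.{u} T} (a : X.carrier) (φ : Weight X) :
    (presheaf X).hom (representable X a) φ = φ.val a := by
  refine le_antisymm ?_ ?_
  · have h := le_presheaf_hom.1 (le_refl ((presheaf X).hom (representable X a) φ)) a
    simpa [representable, X.hom_self, T.one_op] using h
  · refine le_presheaf_hom.2 fun x => ?_
    rw [T.comm]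
    exact φ.op_le x a

/-- The Yoneda embedding `X ⟶ 𝒫 X`. -/
noncomputable def yonedaEmbedding (X : RealCat.{u} T) : X ⟶ presheaf X :=
  Functor.mk (Y := presheaf X) (representable X)
    (fun x y => (yoneda_lemma x (representable X y)).ge)

/-- The element `c` is a colimit of the weight `φ`. -/
def IsColimit {X : RealCat.{u} T} (φ : Weight X) (c : X.carrier) : Prop :=
  ∀ x, X.hom c x = (presheaf X).hom φ (representable X x)

/-- The weight `f_∃ φ = φ ∘ f^*` of `Y`, for a weight `φ` of `X`. -/
noncomputable def imageWeight {X Y : RealCat.{u} T} (f : X ⟶ Y) (φ : Weight X) : Weight Y where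
  val y := ⨆ x, T.op (φ.val x) (Y.hom y (Functor.map f x))
  op_le y y' := by
    rw [T.iSup_op_le]
    intro x
    rw [T.assoc]
    exact (T.mono_right _ _ _ (Y.hom_comp _ _ _)).trans
      (le_iSup (fun x => T.op (φ.val x) (Y.hom y (Functor.map f x))) x)

theorem imageWeight_le {X Y : RealCat.{u} T} (f : X ⟶ Y) (φ : Weight X) (y : Y.carrier) (r : I) :
    (imageWeight f φ).val y ≤ r ↔ ∀ x, T.op (φ.val x) (Y.hom y (Functor.map f x)) ≤ r :=
  iSup_le_iff

theorem le_imageWeight {X Y : RealCat.{u} T} (f : X ⟶ Y) (φ : Weight X) (y : Y.carrier)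
    (x : X.carrier) :
    T.op (φ.val x) (Y.hom y (Functor.map f x)) ≤ (imageWeight f φ).val y :=
  le_iSup (fun x => T.op (φ.val x) (Y.hom y (Functor.map f x))) x

/-- The functor `𝒫 f = f_∃ : 𝒫 X ⟶ 𝒫 Y`. -/
noncomputable def presheafMap {X Y : RealCat.{u} T} (f : X ⟶ Y) : presheaf X ⟶ presheaf Y :=
  Functor.mk (X := presheaf X) (Y := presheaf Y) (imageWeight f) (fun φ ψ => by
    refine le_presheaf_hom.2 fun y => ?_
    change T.op (⨆ x, _) _ ≤ _
    rw [T.iSup_op_le]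
    intro x
    rw [T.assoc, T.comm (Y.hom _ _), ← T.assoc]
    exact (T.mono_left (le_presheaf_hom.1 le_rfl x) _).trans (le_imageWeight f ψ y x))

/-- The weight `x ↦ Φ (𝗒 x)` of `X`, for a weight `Φ` of `𝒫 X`. -/
noncomputable def colimWeight {X : RealCat.{u} T} (Φ : Weight (presheaf X)) : Weight X where
  val x := Φ.val (representable X x)
  op_le x y :=
    (T.mono_right _ _ _ ((yonedaEmbedding X).hom_le x y)).trans (Φ.op_le _ _)

theorem op_le_colimWeight {X : RealCat.{u} T} (Φ : Weight (presheaf X)) (φ : Weight X)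
    (x : X.carrier) : T.op (Φ.val φ) (φ.val x) ≤ Φ.val (representable X x) := by
  rw [← yoneda_lemma x φ]
  exact Φ.op_le _ _

theorem isColimit_colimWeight {X : RealCat.{u} T} (Φ : Weight (presheaf X)) :
    IsColimit (X := presheaf X) Φ (colimWeight Φ) := by
  intro ψ
  refine eq_of_forall_le_iff fun r => ?_
  refine (le_presheaf_hom (X := X)).trans (Iff.trans ?_ (le_presheaf_hom (X := presheaf X)).symm)
  constructor
  · intro h (φ : Weight X)
    refine le_presheaf_hom.2 fun x => ?_
    rw [← T.assoc, T.comm (φ.val x)]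
    exact (T.mono_left (op_le_colimWeight Φ φ x) r).trans (h x)
  · intro h x
    exact (h (representable X x)).trans (yoneda_lemma x ψ).le

/-- The functor `colim : 𝒫 𝒫 X ⟶ 𝒫 X` sending every weight of `𝒫 X` to its colimit;
see `isColimit_colimWeight`. -/
noncomputable def presheafMul (X : RealCat.{u} T) : presheaf (presheaf X) ⟶ presheaf X :=
  Functor.mk (X := presheaf (presheaf X)) (Y := presheaf X) colimWeight
    (fun (Φ Ψ : Weight (presheaf X)) => le_presheaf_hom.2 fun x =>
      (le_presheaf_hom (φ := Φ) (ψ := Ψ)).1 le_rfl (representable X x))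

/-- The presheaf functor on `[0,1]-Cat`. -/
noncomputable def presheafFunctor (T : ContinuousTNorm) : RealCat.{u} T ⥤ RealCat.{u} T where
  obj X := presheaf X
  map f := presheafMap f
  map_id X := by
    refine hom_ext fun (φ : Weight X) => Weight.ext (funext fun x => ?_)
    refine le_antisymm ((imageWeight_le _ _ _ _).2 fun z => φ.op_le x z) ?_
    have h := le_imageWeight (𝟙 X) φ x x
    change T.op (φ.val x) (X.hom x x) ≤ _ at h
    rwa [X.hom_self, T.op_one] at h
  map_comp {X Y Z} f g := by
    refine hom_ext fun (φ : Weight X) => Weight.ext (funext fun z => ?_)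
    refine le_antisymm ((imageWeight_le _ _ _ _).2 fun x => ?_) ((imageWeight_le _ _ _ _).2 fun y => ?_)
    · refine le_trans (T.mono_left ?_ _) (le_imageWeight g (imageWeight f φ) z (Functor.map f x))
      have h := le_imageWeight f φ (Functor.map f x) x
      rwa [Y.hom_self, T.op_one] at h
    · change T.op (⨆ x, _) _ ≤ _
      rw [T.iSup_op_le]
      intro x
      rw [T.assoc]
      refine le_trans (T.mono_right _ _ _ ?_) (le_imageWeight (f ≫ g) φ z x)
      exact (T.mono_left (g.hom_le _ _) _).trans (Z.hom_comp _ _ _)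

/-- The presheaf monad `ℙ = (𝒫, colim, 𝗒)` on `[0,1]-Cat`. -/
noncomputable def presheafMonad (T : ContinuousTNorm) : Monad (RealCat.{u} T) where
  toFunctor := presheafFunctor T
  η :=
    { app := fun X => yonedaEmbedding X
      naturality := fun X Y f => by
        refine hom_ext fun a => Weight.ext (funext fun y => ?_)
        refine le_antisymm ?_ ((imageWeight_le _ _ _ _).2 fun x => ?_)
        · have h := le_imageWeight f (representable X a) y a
          change T.op (X.hom a a) _ ≤ _ at h
          rw [X.hom_self, T.one_op] at h
          exact h
        · exact (T.mono_left (f.hom_le _ _) _).trans (Y.hom_comp _ _ _) }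
  μ :=
    { app := fun X => presheafMul X
      naturality := fun X Y f => by
        refine hom_ext fun (Φ : Weight (presheaf X)) => Weight.ext (funext fun y => ?_)
        refine le_antisymm ((imageWeight_le _ _ _ _).2 fun (φ : Weight X) => ?_)
          ((imageWeight_le _ _ _ _).2 fun x => ?_)
        · refine le_trans (T.mono_right _ _ _ (yoneda_lemma y (imageWeight f φ)).le) ?_
          change T.op _ (⨆ x, _) ≤ _
          rw [T.op_iSup_le]
          intro x
          rw [← T.assoc]
          exact (T.mono_left (op_le_colimWeight Φ φ x) _).trans
            (le_imageWeight f (colimWeight Φ) y x)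
        · refine le_trans (T.mono_right _ _ _ ?_)
            (le_imageWeight (presheafMap f) Φ (representable Y y) (representable X x))
          refine le_trans ?_ (yoneda_lemma y (imageWeight f (representable X x))).ge
          have h := le_imageWeight f (representable X x) y x
          change T.op (X.hom x x) _ ≤ _ at h
          rwa [X.hom_self, T.one_op] at h }
  assoc X := by
    refine hom_ext fun (Ω : Weight (presheaf (presheaf X))) => Weight.ext (funext fun x => ?_)
    refine le_antisymm ((imageWeight_le _ _ _ _).2 fun (Φ : Weight (presheaf X)) => ?_) ?_
    · refine le_trans (T.mono_right _ _ _ (yoneda_lemma x (colimWeight Φ)).le) ?_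
      exact op_le_colimWeight Ω Φ (representable X x)
    · refine le_trans ?_ (le_imageWeight (presheafMul X) Ω (representable X x)
        (representable (presheaf X) (representable X x)))
      have h : (presheaf X).hom (representable X x)
          (colimWeight (representable (presheaf X) (representable X x))) = 1 :=
        (yoneda_lemma x _).trans ((presheaf X).hom_self (representable X x))
      exact ((T.mono_right _ _ _ h.ge).trans' (T.op_one _).ge)
  left_unit X := by
    refine hom_ext fun (φ : Weight X) => Weight.ext (funext fun x => ?_)
    exact yoneda_lemma x φ
  right_unit X := by
    refine hom_ext fun (φ : Weight X) => Weight.ext (funext fun x => ?_)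
    refine le_antisymm ((imageWeight_le _ _ _ _).2 fun z => ?_) ?_
    · exact (T.mono_right _ _ _ (yoneda_lemma x (representable X z)).le).trans (φ.op_le x z)
    · refine le_trans ?_ (le_imageWeight (yonedaEmbedding X) φ (representable X x) x)
      exact (T.mono_right _ _ _ ((presheaf X).hom_self (representable X x)).ge).trans'
        (T.op_one _).ge

/-- `A` is (isomorphic to) a subalgebra of `B` in `ℙ-Alg`: there is a fully faithful
`ℙ`-homomorphism from `A` to `B`. -/
def IsSubalgebraOf (A B : (presheafMonad.{u} T).Algebra) : Prop :=
  ∃ i : A ⟶ B, FullyFaithful i.f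

end RealCat

/-!
A `ℙ`-algebra `A` carries a left adjoint `α` of its Yoneda embedding, so `α φ` is the colimit of
`φ`.

If `&` is isomorphic to the Łukasiewicz t-norm, then the negation `¬x = x → 0` is an involution
(`imp_zero_imp_zero_of_isIsomorphic`). Hence `a ↦ ¬A(a, -)` is a fully faithful homomorphism from
`A` to `𝒫 A`: full faithfulness is contraposition, and preservation of colimits is De Morgan's law
`¬ inf_a (φ a → A(a,x)) = sup_a φ a & ¬A(a,x)`.

Conversely, only the algebra `[0,1]ᵒᵖ`, with hom `(x, y) ↦ y → x`, is needed. The tensor of `p` with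
`p` is there the bottom element `1`, so a homomorphism `i` to a free algebra satisfies
`p & i(p)(x) = 0`; if `i` is fully faithful then `i(p) ≠ 0` for `p ≠ 1`. So every `p ≠ 1`
is a zero divisor (`exists_op_eq_zero_of_isSubalgebraOf`), which rules out idempotents other than
`0` and `1`. That such a t-norm is isomorphic to the Łukasiewicz one is the nilpotent case of the
classification of continuous Archimedean t-norms: repeated square roots `e n` of some `c > 0` with
`c & c = 0` tend to `1`, and the limit `F t` of the powers of `e n` with exponent `⌊t * 2 ^ n⌋` is a
one-parameter semigroup, `F (s + t) = F s & F t`. It decreases strictly from `1` to `0` on an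
interval `[0, τ]`, and `u ↦ F (τ * (1 - u))` is the inverse of the required isomorphism.
-/

open Filter Topology

namespace ContinuousTNorm

variable (T : ContinuousTNorm)

/-! ### Continuous t-norms -/

theorem zero_op (x : I) : T.op 0 x = 0 := by rw [T.comm, T.op_zero]

theorem op_imp_le (x y : I) : T.op x (T.imp x y) ≤ y := T.le_imp_iff.1 le_rfl

theorem one_imp (x : I) : T.imp 1 x = x :=
  eq_of_forall_le_iff fun z => by rw [T.le_imp_iff, T.one_op]

theorem imp_self (x : I) : T.imp x x = 1 :=
  le_antisymm le_one' (T.le_imp_iff.2 (T.op_one x).le)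

theorem imp_anti {x x' : I} (h : x ≤ x') (y : I) : T.imp x' y ≤ T.imp x y :=
  T.le_imp_iff.2 ((T.mono_left h _).trans (T.op_imp_le x' y))

theorem tendsto_op {α : Type*} {l : Filter α} {f g : α → I} {x y : I}
    (hf : Tendsto f l (𝓝 x)) (hg : Tendsto g l (𝓝 y)) :
    Tendsto (fun a => T.op (f a) (g a)) l (𝓝 (T.op x y)) :=
  (T.continuous_op.tendsto (x, y)).comp (hf.prodMk_nhds hg)

theorem exists_op_eq_of_le {p q : I} (h : q ≤ p) : ∃ w, T.op p w = q := by
  have hc : Continuous (T.op p) :=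
    T.continuous_op.comp (continuous_const.prodMk continuous_id)
  exact mem_range_of_exists_le_of_exists_ge hc
    ⟨0, by rw [T.op_zero]; exact nonneg'⟩ ⟨1, by rwa [T.op_one]⟩

theorem exists_op_self_eq (x : I) : ∃ w, T.op w w = x := by
  have hc : Continuous fun w => T.op w w :=
    T.continuous_op.comp (continuous_id.prodMk continuous_id)
  exact mem_range_of_exists_le_of_exists_ge hc
    ⟨0, by rw [T.op_zero]; exact nonneg'⟩ ⟨1, by rw [T.op_one]; exact le_one'⟩

theorem eq_one_of_idempotent (hT : ∀ p : I, p ≠ 1 → ∃ q, 0 < q ∧ T.op p q = 0) {p : I}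
    (hp : T.op p p = p) (h0 : 0 < p) : p = 1 := by
  by_contra h1
  obtain ⟨q, hq, hpq⟩ := hT p h1
  rcases le_total q p with h | h
  · obtain ⟨w, rfl⟩ := T.exists_op_eq_of_le h
    rw [← T.assoc, hp] at hpq
    exact hq.ne' hpq
  · have := T.mono_right p p q h
    rw [hp, hpq] at this
    exact this.not_gt h0

/-- Negation is an involution for every t-norm isomorphic to the Łukasiewicz one. -/
theorem imp_zero_imp_zero_of_isIsomorphic (hT : T.IsIsomorphic lukasiewicz) (x : I) :
    T.imp (T.imp x 0) 0 = x := by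
  obtain ⟨f, hf⟩ := hT
  have key : ∀ x y : I, T.op x y ≤ 0 ↔ (f x : ℝ) + f y ≤ 1 := fun x y => by
    have hf0 : f 0 = 0 := f.map_bot
    rw [← f.le_iff_le, hf, hf0, ← Subtype.coe_le_coe]
    change max ((f x : ℝ) + f y - 1) 0 ≤ 0 ↔ _
    simp
  refine le_antisymm ?_ (T.le_imp_iff.2 (by rw [T.comm]; exact T.op_imp_le x 0))
  have hw : f.symm (σ (f x)) ≤ T.imp x 0 := by
    rw [T.le_imp_iff, key, f.apply_symm_apply, coe_symm_eq]
    linarith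
  have h := (key _ _).1 (T.op_imp_le (T.imp x 0) 0)
  have h' : ((σ (f x) : I) : ℝ) ≤ f (T.imp x 0) := by
    rw [← f.apply_symm_apply (σ (f x))]
    exact f.monotone hw
  rw [coe_symm_eq] at h'
  rw [← f.le_iff_le, ← Subtype.coe_le_coe]
  linarith

/-! ### Powers and iterated square roots -/

/-- The `n`-fold product `x & ⋯ & x`. -/
def npow (x : I) : ℕ → I
  | 0 => 1
  | n + 1 => T.op (npow x n) x

theorem npow_one (x : I) : T.npow x 1 = x := T.one_op x

theorem npow_add (x : I) (m n : ℕ) : T.npow x (m + n) = T.op (T.npow x m) (T.npow x n) := by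
  induction n with
  | zero => exact (T.op_one _).symm
  | succ n ih =>
    change T.op (T.npow x (m + n)) x = T.op _ (T.op (T.npow x n) x)
    rw [ih, T.assoc]

theorem npow_anti (x : I) : Antitone (T.npow x) :=
  antitone_nat_of_succ_le fun _ => T.op_le_left _ _

theorem npow_two_mul (x : I) (n : ℕ) : T.npow x (2 * n) = T.npow (T.op x x) n := by
  induction n with
  | zero => rfl
  | succ n ih =>
    rw [Nat.mul_succ, npow_add, ih]
    change T.op _ (T.op (T.op 1 x) x) = T.op _ _
    rw [T.one_op]

/-- A sequence starting at `c` in which each term is a square root of the preceding one. -/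
noncomputable def iterSqrt (c : I) : ℕ → I
  | 0 => c
  | n + 1 => (T.exists_op_self_eq (iterSqrt c n)).choose

theorem iterSqrt_op_self (c : I) (n : ℕ) :
    T.op (T.iterSqrt c (n + 1)) (T.iterSqrt c (n + 1)) = T.iterSqrt c n :=
  (T.exists_op_self_eq (T.iterSqrt c n)).choose_spec

theorem iterSqrt_mono (c : I) : Monotone (T.iterSqrt c) :=
  monotone_nat_of_le_succ fun n => by
    rw [← T.iterSqrt_op_self c n]; exact T.op_le_left _ _

theorem npow_iterSqrt_add (c : I) (n k m : ℕ) :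
    T.npow (T.iterSqrt c (n + m)) (2 ^ m * k) = T.npow (T.iterSqrt c n) k := by
  induction m with
  | zero => simp
  | succ m ih =>
    rw [pow_succ', mul_assoc, npow_two_mul, ← add_assoc, iterSqrt_op_self, ih]

/-- The limit of the iterated square roots is a nonzero idempotent. -/
theorem tendsto_iterSqrt (hT : ∀ p : I, p ≠ 1 → ∃ q, 0 < q ∧ T.op p q = 0) {c : I} (hc : 0 < c) :
    Tendsto (T.iterSqrt c) atTop (𝓝 1) := by
  have h := tendsto_atTop_iSup (T.iterSqrt_mono c)
  have h' := (tendsto_add_atTop_iff_nat 1).2 h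
  have h2 := T.tendsto_op h' h'
  simp only [iterSqrt_op_self] at h2
  rwa [T.eq_one_of_idempotent hT (tendsto_nhds_unique h2 h)
    (hc.trans_le (le_iSup (T.iterSqrt c) 0))] at h

/-! ### The one-parameter semigroup through an element -/

/-- The power of `c` with real exponent `t ≥ 0`, as the limit of dyadic powers. -/
noncomputable def realPow (c : I) (t : ℝ) : I :=
  ⨅ n : ℕ, T.npow (T.iterSqrt c n) ⌊t * 2 ^ n⌋₊

theorem realPow_anti (c : I) : Antitone (T.realPow c) := fun s t h =>
  iInf_mono fun n => T.npow_anti _ (Nat.floor_mono (by gcongr))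

theorem tendsto_realPow (c : I) {t : ℝ} (ht : 0 ≤ t) :
    Tendsto (fun n : ℕ => T.npow (T.iterSqrt c n) ⌊t * 2 ^ n⌋₊) atTop (𝓝 (T.realPow c t)) := by
  refine tendsto_atTop_iInf (antitone_nat_of_succ_le fun n => ?_)
  rw [← T.npow_iterSqrt_add c n _ 1]
  refine T.npow_anti _ (Nat.le_floor ?_)
  have := Nat.floor_le (show 0 ≤ t * 2 ^ n by positivity)
  push_cast
  rw [pow_succ]
  linarith

theorem realPow_zero (c : I) : T.realPow c 0 = 1 := by
  simp [realPow, npow]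

theorem realPow_div (c : I) (k m : ℕ) :
    T.realPow c (k / 2 ^ m) = T.npow (T.iterSqrt c m) k := by
  refine tendsto_nhds_unique ((tendsto_add_atTop_iff_nat m).2
    (T.tendsto_realPow c (t := k / 2 ^ m) (by positivity))) ?_
  have h : ∀ n : ℕ, ⌊(k / 2 ^ m * 2 ^ (n + m) : ℝ)⌋₊ = 2 ^ n * k := fun n => by
    rw [← Nat.floor_natCast (R := ℝ) (2 ^ n * k)]
    congr 1
    push_cast
    field_simp
    ring
  refine tendsto_const_nhds.congr fun n => ?_
  rw [h, Nat.add_comm n m, npow_iterSqrt_add]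

theorem realPow_inv_two_pow (c : I) (m : ℕ) :
    T.realPow c (1 / 2 ^ m) = T.iterSqrt c m := by
  simpa [npow_one] using T.realPow_div c 1 m

theorem realPow_add (hT : ∀ p : I, p ≠ 1 → ∃ q, 0 < q ∧ T.op p q = 0) {c : I} (hc : 0 < c)
    {s t : ℝ} (hs : 0 ≤ s) (ht : 0 ≤ t) :
    T.realPow c (s + t) = T.op (T.realPow c s) (T.realPow c t) := by
  have hst := T.tendsto_op (T.tendsto_realPow c hs) (T.tendsto_realPow c ht)
  have hlow := T.tendsto_op hst (T.tendsto_iterSqrt hT hc)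
  rw [T.op_one] at hlow
  refine tendsto_nhds_unique (T.tendsto_realPow c (add_nonneg hs ht))
    (tendsto_of_tendsto_of_tendsto_of_le_of_le hlow hst (fun n => ?_) fun n => ?_)
  -- The integer part of a sum exceeds the sum of the integer parts by at most one.
  · have h : ⌊(s + t) * 2 ^ n⌋₊ ≤ ⌊s * 2 ^ n⌋₊ + ⌊t * 2 ^ n⌋₊ + 1 := by
      refine Nat.lt_succ_iff.1 ((Nat.floor_lt (by positivity)).2 ?_)
      have h1 := Nat.lt_floor_add_one (s * 2 ^ n)
      have h2 := Nat.lt_floor_add_one (t * 2 ^ n)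
      push_cast
      linarith
    dsimp only
    rw [← npow_add]
    exact T.npow_anti _ h
  · have h : ⌊s * 2 ^ n⌋₊ + ⌊t * 2 ^ n⌋₊ ≤ ⌊(s + t) * 2 ^ n⌋₊ := by
      refine Nat.le_floor ?_
      have h1 := Nat.floor_le (show 0 ≤ s * 2 ^ n by positivity)
      have h2 := Nat.floor_le (show 0 ≤ t * 2 ^ n by positivity)
      push_cast
      linarith
    dsimp only
    rw [← npow_add]
    exact T.npow_anti _ h

/-- The exponent of `x` is the least `t` with `realPow c t ≤ x`. -/
theorem exists_realPow_eq (hT : ∀ p : I, p ≠ 1 → ∃ q, 0 < q ∧ T.op p q = 0) {c : I} (hc : 0 < c)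
    (hcc : T.op c c = 0) (x : I) :
    ∃ t, 0 ≤ t ∧ T.realPow c t = x ∧ ∀ s, 0 ≤ s → s < t → x < T.realPow c s := by
  set S : Set ℝ := {t | 0 ≤ t ∧ T.realPow c t ≤ x} with hS
  have hbdd : BddBelow S := ⟨0, fun t ht => ht.1⟩
  have hne : S.Nonempty := by
    -- `realPow c 2 = c & c = 0`.
    refine ⟨2, zero_le_two, ?_⟩
    have h := T.realPow_div c 2 0
    have h2 : T.npow (T.iterSqrt c 0) 2 = 0 := by
      change T.op (T.op 1 c) c = 0
      rw [T.one_op, hcc]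
    rw [h2] at h
    norm_num at h
    rw [h]
    exact nonneg'
  have h0 : 0 ≤ sInf S := le_csInf hne fun t ht => ht.1
  have hlt : ∀ s, 0 ≤ s → s < sInf S → x < T.realPow c s := fun s hs hst => by
    by_contra h
    exact notMem_of_lt_csInf hst hbdd ⟨hs, not_lt.1 h⟩
  have hlim : ∀ y : I, Tendsto (fun n => T.op y (T.iterSqrt c n)) atTop (𝓝 y) := fun y => by
    simpa only [T.op_one] using T.tendsto_op tendsto_const_nhds (T.tendsto_iterSqrt hT hc)
  refine ⟨sInf S, h0, le_antisymm ?_ ?_, hlt⟩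
  · refine le_of_tendsto' (hlim _) fun n => ?_
    rw [← realPow_inv_two_pow, ← T.realPow_add hT hc h0 (by positivity)]
    obtain ⟨t, ht, htS⟩ := exists_lt_of_csInf_lt hne
      (lt_add_of_pos_right (sInf S) (show (0 : ℝ) < 1 / 2 ^ n by positivity))
    exact (T.realPow_anti c htS.le).trans ht.2
  · rcases h0.eq_or_lt with h | h
    · rw [← h, realPow_zero]
      exact le_one'
    · have hev : ∀ᶠ n : ℕ in atTop, (1 / 2 ^ n : ℝ) < sInf S := by
        have : Tendsto (fun n : ℕ => (1 / 2 : ℝ) ^ n) atTop (𝓝 0) :=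
          tendsto_pow_atTop_nhds_zero_of_lt_one (by norm_num) (by norm_num)
        simpa only [one_div_pow] using this.eventually_lt_const h
      refine le_of_tendsto (hlim x) (hev.mono fun n hn => ?_)
      have hp : (0 : ℝ) < 1 / 2 ^ n := by positivity
      have h1 := T.realPow_add hT hc (sub_nonneg.2 hn.le) hp.le
      rw [sub_add_cancel, realPow_inv_two_pow] at h1
      rw [h1]
      exact T.mono_left (hlt _ (sub_nonneg.2 hn.le) (by linarith)).le _

/-- A continuous t-norm in which every element other than `1` is a zero divisor is isomorphic to
the Łukasiewicz t-norm. -/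
theorem isIsomorphic_lukasiewicz (hT : ∀ p : I, p ≠ 1 → ∃ q, 0 < q ∧ T.op p q = 0) :
    T.IsIsomorphic lukasiewicz := by
  obtain ⟨c, hc, hcc⟩ : ∃ c : I, 0 < c ∧ T.op c c = 0 := by
    have h1 : σ (⟨1 / 2, by norm_num, by norm_num⟩ : I) ≠ 1 := by
      intro h
      have := congrArg Subtype.val h
      norm_num [coe_symm_eq] at this
    have h2 : 0 < σ (⟨1 / 2, by norm_num, by norm_num⟩ : I) := by
      rw [← Subtype.coe_lt_coe]
      norm_num [coe_symm_eq]
    obtain ⟨q, hq, hpq⟩ := hT _ h1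
    exact ⟨min _ q, lt_min h2 hq, le_antisymm
      ((T.op_mono (min_le_left _ _) (min_le_right _ _)).trans hpq.le) nonneg'⟩
  set F := T.realPow c with hF
  have hadd : ∀ {s t : ℝ}, 0 ≤ s → 0 ≤ t → F (s + t) = T.op (F s) (F t) :=
    fun hs ht => T.realPow_add hT hc hs ht
  obtain ⟨τ, hτ0, hFτ, hlt⟩ := T.exists_realPow_eq hT hc hcc 0
  have hτ : 0 < τ := by
    refine hτ0.lt_of_ne fun h => ?_
    rw [← h, realPow_zero] at hFτ
    exact one_ne_zero hFτ
  have hzero : ∀ t, τ ≤ t → F t = 0 := fun t ht =>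
    le_antisymm ((T.realPow_anti c ht).trans hFτ.le) nonneg'
  have hstrict : ∀ s t, 0 ≤ s → s < t → t ≤ τ → F t < F s := by
    intro s t hs hst ht
    refine (T.realPow_anti c hst.le).lt_of_ne fun h => ?_
    have hu : 0 < t - s := sub_pos.2 hst
    have habs : T.op (F s) (F (t - s)) = F s := by
      rw [← hadd hs hu.le, add_sub_cancel, hF, h]
    -- `F s` absorbs `F (t - s)`, hence all its powers, and some of these vanish.
    have hn : ∀ n : ℕ, T.op (F s) (F (n * (t - s))) = F s := fun n => by
      induction n with
      | zero => rw [Nat.cast_zero, zero_mul, hF, realPow_zero, T.op_one]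
      | succ n ih =>
        rw [Nat.cast_succ, add_one_mul, hadd (by positivity) hu.le, ← T.assoc, ih, habs]
    obtain ⟨n, hn'⟩ := exists_nat_ge (τ / (t - s))
    have := hn n
    rw [hzero _ ((div_le_iff₀ hu).1 hn'), T.op_zero] at this
    exact (hlt s hs (hst.trans_le ht)).ne this
  set g : I → I := fun u => F (τ * (1 - u)) with hg
  have hg_mono : StrictMono g := fun u v huv => by
    have h : (u : ℝ) < v := huv
    refine hstrict _ _ (mul_nonneg hτ0 (by linarith [v.2.2])) ?_ ?_
    · exact mul_lt_mul_of_pos_left (by linarith) hτ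
    · exact mul_le_of_le_one_right hτ0 (by linarith [u.2.1])
  have hg_surj : Function.Surjective g := fun x => by
    obtain ⟨t, ht, hFt, ht'⟩ := T.exists_realPow_eq hT hc hcc x
    have htτ : t ≤ τ := by
      by_contra! h
      have := ht' τ hτ0 h
      rw [hFτ] at this
      exact this.not_ge nonneg'
    refine ⟨⟨1 - t / τ, ?_, ?_⟩, ?_⟩
    · linarith [(div_le_one hτ).2 htτ]
    · linarith [div_nonneg ht hτ0]
    · rw [← hFt]
      change F _ = F t
      congr 1
      field_simp
      ring
  let e : I ≃o I := hg_mono.orderIsoOfSurjective g hg_surj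
  have hop : ∀ u v : I, g (lukasiewicz.op u v) = T.op (g u) (g v) := fun u v => by
    have hu := u.2.2
    have hv := v.2.2
    have h : T.op (g u) (g v) = F (τ * (1 - u) + τ * (1 - v)) :=
      (hadd (mul_nonneg hτ0 (by linarith)) (mul_nonneg hτ0 (by linarith))).symm
    rw [h]
    change F (τ * (1 - max ((u : ℝ) + v - 1) 0)) = _
    rcases le_total ((u : ℝ) + v - 1) 0 with h | h
    · rw [max_eq_right h, hzero _ (by linarith), hzero]
      nlinarith
    · rw [max_eq_left h]
      congr 1
      ring
  refine ⟨e.symm, fun x y => ?_⟩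
  rw [OrderIso.symm_apply_eq]
  change _ = g _
  rw [hop]
  change _ = T.op (e _) (e _)
  rw [e.apply_symm_apply, e.apply_symm_apply]

end ContinuousTNorm

namespace RealCat

variable {T : ContinuousTNorm}

/-! ### Algebras of the presheaf monad -/

theorem algebra_unit_apply (A : (presheafMonad.{u} T).Algebra) (a : A.A.carrier) :
    Functor.map A.a (representable A.A a) = a :=
  congrArg (fun f : A.A ⟶ A.A => Functor.map f a) A.unit

/-- The structure map of an algebra sends every weight to its colimit. -/
theorem isColimit_algebra (A : (presheafMonad.{u} T).Algebra) (φ : Weight A.A) :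
    IsColimit φ (Functor.map A.a φ) := by
  intro x
  refine le_antisymm (le_presheaf_hom.2 fun y => ?_) ?_
  · have h : φ.val y ≤ A.A.hom y (Functor.map A.a φ) := by
      have := Functor.hom_le A.a (representable A.A y) φ
      rw [algebra_unit_apply] at this
      exact (yoneda_lemma y φ).ge.trans this
    refine (T.mono_left h _).trans ?_
    rw [T.comm]
    exact A.A.hom_comp _ _ _
  · have := Functor.hom_le A.a φ (representable A.A x)
    rwa [algebra_unit_apply] at this

/-- A homomorphism into a free algebra preserves colimits, and those of weights are computed
pointwise. -/
theorem hom_free_apply {A : (presheafMonad.{u} T).Algebra} {X : RealCat.{u} T}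
    (i : A ⟶ (presheafMonad T).free.obj X) (φ : Weight A.A) (x : X.carrier) :
    Weight.val (X := X) (Functor.map i.f (Functor.map A.a φ)) x =
      ⨆ a, T.op (φ.val a) (Weight.val (X := X) (Functor.map i.f a) x) := by
  have h := congrArg
    (fun f : presheaf A.A ⟶ presheaf X => Weight.val (X := X) (Functor.map f φ) x) i.h
  refine h.symm.trans (iSup_congr fun a => congrArg _ ?_)
  exact yoneda_lemma x _

/-! ### Embedding an algebra by negated homs -/

/-- The functor `a ↦ ¬A(a, -)`. -/
noncomputable def negHom (A : RealCat.{u} T) : A ⟶ presheaf A :=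
  Functor.mk (Y := presheaf A)
    (fun a =>
      { val := fun x => T.imp (A.hom a x) 0
        op_le := fun x y => by
          rw [T.le_imp_iff, T.comm (T.imp _ _), ← T.assoc, T.comm (A.hom a x)]
          exact (T.mono_left (A.hom_comp _ _ _) _).trans (T.op_imp_le _ _) })
    (fun a b => le_presheaf_hom.2 fun x => by
      rw [T.le_imp_iff, T.comm (T.imp _ _), ← T.assoc]
      exact (T.mono_left (A.hom_comp _ _ _) _).trans (T.op_imp_le _ _))

theorem fullyFaithful_negHom (hT : ∀ x, T.imp (T.imp x 0) 0 = x) (A : RealCat.{u} T) :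
    FullyFaithful (negHom A) := by
  intro a b
  refine le_antisymm ((negHom A).hom_le a b) ?_
  have h := le_presheaf_hom.1 (le_refl
    ((presheaf A).hom (Functor.map (negHom A) a) (Functor.map (negHom A) b))) b
  change T.op (T.imp (A.hom a b) 0) _ ≤ T.imp (A.hom b b) 0 at h
  rw [A.hom_self, T.one_imp, ← T.le_imp_iff, hT] at h
  exact h

theorem imp_zero_algebra_hom (hT : ∀ x, T.imp (T.imp x 0) 0 = x)
    (A : (presheafMonad.{u} T).Algebra) (φ : Weight A.A) (x : A.A.carrier) :
    T.imp (A.A.hom (Functor.map A.a φ) x) 0 = ⨆ a, T.op (φ.val a) (T.imp (A.A.hom a x) 0) := by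
  have hcolim := isColimit_algebra A φ x
  refine le_antisymm ?_ (iSup_le fun a => ?_)
  · rw [← hT (⨆ a, T.op (φ.val a) (T.imp (A.A.hom a x) 0))]
    refine T.imp_anti ?_ 0
    rw [hcolim]
    refine le_presheaf_hom.2 fun a => ?_
    change _ ≤ A.A.hom a x
    rw [← hT (A.A.hom a x), T.le_imp_iff, ← T.assoc, T.comm _ (φ.val a)]
    exact (T.mono_left (le_iSup (fun a => T.op (φ.val a) (T.imp (A.A.hom a x) 0)) a) _).trans
      (T.op_imp_le _ _)
  · have h := le_presheaf_hom.1 hcolim.le a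
    change _ ≤ A.A.hom a x at h
    rw [T.le_imp_iff, ← T.assoc, T.comm _ (φ.val a)]
    exact (T.mono_left h _).trans (T.op_imp_le _ _)

theorem isSubalgebraOf_free (hT : ∀ x, T.imp (T.imp x 0) 0 = x)
    (A : (presheafMonad.{u} T).Algebra) :
    IsSubalgebraOf A ((presheafMonad T).free.obj A.A) := by
  refine ⟨⟨negHom A.A, ?_⟩, fullyFaithful_negHom hT A.A⟩
  refine hom_ext fun (φ : Weight A.A) => Weight.ext (funext fun x => ?_)
  refine Eq.trans (iSup_congr fun a => congrArg _ ?_) (imp_zero_algebra_hom hT A φ x).symm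
  exact yoneda_lemma x _

/-! ### The dual of the unit interval -/

/-- The real-enriched category `[0,1]ᵒᵖ`, with hom `(x, y) ↦ (y → x)`. -/
noncomputable def unitIntervalOp (T : ContinuousTNorm) : RealCat.{u} T where
  carrier := ULift.{u} I
  hom x y := T.imp y.down x.down
  hom_self x := T.imp_self x.down
  hom_comp x y z := by
    rw [T.le_imp_iff, ← T.assoc]
    exact (T.mono_left (T.op_imp_le _ _) _).trans (T.op_imp_le _ _)

/-- The colimit of a weight of `[0,1]ᵒᵖ`. -/
noncomputable def unitIntervalOpColim (φ : Weight (unitIntervalOp.{u} T)) : I :=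
  ⨅ x : ULift.{u} I, T.imp (φ.val x) x.down

theorem le_unitIntervalOpColim {φ : Weight (unitIntervalOp.{u} T)} {r : I} :
    r ≤ unitIntervalOpColim φ ↔ ∀ x : ULift.{u} I, T.op (φ.val x) r ≤ x.down := by
  simp only [unitIntervalOpColim, le_iInf_iff, T.le_imp_iff]

theorem unitIntervalOpColim_representable (x : ULift.{u} I) :
    unitIntervalOpColim (representable (unitIntervalOp.{u} T) x) = x.down := by
  refine le_antisymm ?_ (le_unitIntervalOpColim.2 fun z => ?_)
  · have h := le_unitIntervalOpColim.1
      (le_refl (unitIntervalOpColim (representable (unitIntervalOp.{u} T) x))) x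
    change T.op (T.imp x.down x.down) _ ≤ x.down at h
    rwa [T.imp_self, T.one_op] at h
  · rw [T.comm]
    exact T.op_imp_le _ _

/-- The `ℙ`-algebra structure on `[0,1]ᵒᵖ`. -/
noncomputable def unitIntervalOpAlgebra (T : ContinuousTNorm) : (presheafMonad.{u} T).Algebra where
  A := unitIntervalOp T
  a := Functor.mk (X := presheaf (unitIntervalOp T)) (Y := unitIntervalOp T)
    (fun φ => ⟨unitIntervalOpColim φ⟩) (fun φ ψ => by
      refine T.le_imp_iff.2 (le_unitIntervalOpColim.2 fun x => ?_)
      have h := le_presheaf_hom.1 (le_refl ((presheaf (unitIntervalOp T)).hom φ ψ)) x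
      rw [T.comm (unitIntervalOpColim ψ), ← T.assoc]
      exact (T.mono_left h _).trans (le_unitIntervalOpColim.1 le_rfl x))
  unit := hom_ext fun x => ULift.ext _ _ (unitIntervalOpColim_representable x)
  assoc := by
    refine hom_ext fun (Φ : Weight (presheaf (unitIntervalOp T))) => ULift.ext _ _ ?_
    refine eq_of_forall_le_iff fun r => ?_
    refine le_unitIntervalOpColim.trans (Iff.trans ?_ le_unitIntervalOpColim.symm)
    constructor
    · intro h z
      refine T.iSup_op_le.2 fun (φ : Weight (unitIntervalOp T)) => ?_
      have hr : T.op (Φ.val φ) r ≤ unitIntervalOpColim φ :=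
        le_unitIntervalOpColim.2 fun x => by
          rw [← T.assoc, T.comm (φ.val x)]
          exact (T.mono_left (op_le_colimWeight Φ φ x) r).trans (h x)
      change T.op (T.op _ (T.imp (unitIntervalOpColim φ) z.down)) r ≤ z.down
      rw [T.assoc, T.comm (T.imp _ _), ← T.assoc]
      exact (T.mono_left hr _).trans (T.op_imp_le _ _)
    · intro h x
      have h' := T.iSup_op_le.1 (h x) (representable (unitIntervalOp T) x)
      change T.op (T.op _ (T.imp (unitIntervalOpColim _) x.down)) r ≤ x.down at h'
      rw [unitIntervalOpColim_representable] at h'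
      rwa [T.imp_self, T.op_one] at h'

/-- If `[0,1]ᵒᵖ` is a subalgebra of a free algebra, every `p ≠ 1` is a zero divisor. -/
theorem exists_op_eq_zero_of_isSubalgebraOf {X : RealCat.{u} T}
    (h : IsSubalgebraOf (unitIntervalOpAlgebra T) ((presheafMonad T).free.obj X)) (p : I)
    (hp : p ≠ 1) : ∃ q, 0 < q ∧ T.op p q = 0 := by
  obtain ⟨i, hi⟩ := h
  let v : I → X.carrier → I := fun p => Weight.val (X := X) (Functor.map i.f ⟨p⟩)
  have hcolim : ∀ (φ : Weight (unitIntervalOp T)) x, v (unitIntervalOpColim φ) x =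
      ⨆ a : ULift I, T.op (φ.val a) (v a.down x) := fun φ x => hom_free_apply i φ x
  -- `1` is the bottom element of `[0,1]ᵒᵖ`, that is, the colimit of the zero weight.
  have hbot : ∀ x, v 1 x = 0 := fun x => by
    let φ : Weight (unitIntervalOp T) := ⟨fun _ => 0, fun _ _ => (T.zero_op _).le⟩
    have hφ : unitIntervalOpColim φ = 1 :=
      le_antisymm le_one' (le_unitIntervalOpColim.2 fun x => (T.zero_op 1).trans_le nonneg')
    rw [← hφ, hcolim]
    simp [φ, T.zero_op]
  -- It is also the tensor of `p` with `p`.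
  have hpv : ∀ x, T.op p (v p x) = 0 := fun x => by
    let φ : Weight (unitIntervalOp T) :=
      ⟨fun y => T.op p ((unitIntervalOp T).hom y ⟨p⟩), fun y z => by
        rw [T.assoc]
        exact T.mono_right _ _ _ ((unitIntervalOp T).hom_comp _ _ _)⟩
    have hφ : unitIntervalOpColim φ = 1 :=
      le_antisymm le_one' (le_unitIntervalOpColim.2 fun x => by
        rw [T.op_one]
        exact T.op_imp_le _ _)
    have h1 : T.op (φ.val ⟨p⟩) (v p x) ≤ 0 := by
      rw [← hbot x, ← hφ, hcolim]
      exact le_iSup (fun a : ULift I => T.op (φ.val a) (v a.down x)) ⟨p⟩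
    have h2 : φ.val ⟨p⟩ = p := by
      change T.op p (T.imp p p) = p
      rw [T.imp_self, T.op_one]
    rw [h2] at h1
    exact le_antisymm h1 nonneg'
  by_contra! hq
  have hv : ∀ x, v p x = 0 := fun x => by
    by_contra hne
    exact hq _ (lt_of_le_of_ne nonneg' (Ne.symm hne)) (hpv x)
  refine hp (le_antisymm le_one' ?_)
  have hpone : (1 : I) ≤ T.imp 1 p := by
    refine le_trans ?_ (hi (⟨p⟩ : ULift I) (⟨1⟩ : ULift I)).ge
    refine (le_presheaf_hom (X := X)).2 fun x => ?_
    rw [T.op_one]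
    exact (hv x).trans_le nonneg'
  rwa [T.one_imp] at hpone

end RealCat

theorem mainTheorem1 (T : ContinuousTNorm) :
    T.IsIsomorphic ContinuousTNorm.lukasiewicz ↔
      ∀ A : (RealCat.presheafMonad.{u} T).Algebra,
        ∃ X : RealCat.{u} T,
          RealCat.IsSubalgebraOf A ((RealCat.presheafMonad T).free.obj X) := by
  constructor
  · intro h A
    exact ⟨A.A, RealCat.isSubalgebraOf_free (T.imp_zero_imp_zero_of_isIsomorphic h) A⟩
  · intro h
    obtain ⟨X, hX⟩ := h (RealCat.unitIntervalOpAlgebra T)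
    exact T.isIsomorphic_lukasiewicz (RealCat.exists_op_eq_zero_of_isSubalgebraOf hX)
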